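/- **Setting.** A path of length $s_e>0$ carries torque constraints $A_i(s)\ddot s+B_i(s)\dot s^2+C_i(s)\le 0$, $i=1,\dots,m$, and end velocities $\dot s_0,\dot s_e$ are prescribed at $s=0$ and $s=s_e$. Put $$\alpha(s,v)=\max_{A_i(s)<0}\frac{-B_i(s)v^2-C_i(s)}{A_i(s)},\qquad \beta(s,v)=\min_{A_i(s)>0}\frac{-B_i(s)v^2-C_i(s)}{A_i(s)},$$ and let $MVC(s)$ be the least $v\ge 0$ at which the torque constraints are saturated: $\alpha(s,v)=\beta(s,v)$, or $B_i(s)v^2+C_i(s)=0$ for some $i$ with $A_i(s)=0$. Assume that $A_i,B_i,C_i$ are bounded (for instance piecewise continuous) on $[0,s_e]$; that for every $s$ both signs occur among the $A_i(s)$ and $MVC(s)$ exists; and that there are $\varepsilon>0$ and $M$ such that for every $s\in[0,s_e]$ some acceleration $a$ with $|a|\le M$ satisfies $A_i(s)a+C_i(s)\le-\varepsilon$ for all $i$ (at zero velocity the torques are strictly within their bounds). For a limit curve $L:[0,s_e]\to\mathbb R$, the admissible region is $\{(s,v):0\le s\le s_e,\ 0\le v\le L(s)\}$. A point $(s,L(s))$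 is a *switch point* of $L$ if it is a tangent point ($L(s)>0$ and $L'(s)=\alpha(s,L(s))/L(s)=\beta(s,L(s))/L(s)$), a discontinuity point ($L$ is discontinuous at $s$), or a zero-inertia point ($A_i(s)=0$ for some $i$). A $\beta$-profile is integrated forward with slope $dv/ds=\beta(s,v)/v$, and an $\alpha$-profile backward with slope $dv/ds=\alpha(s,v)/v$ (finitely many corners allowed). **The NI method with limit curve $L$.** From $(0,\dot s_0)$ integrate a $\beta$-profile forward until it hits $L$, the line $v=0$ (then the path is not traversable) or the line $s=s_e$. If it hits $L$, search forward along $L$ from the hitting point for the first switch point. If there is one, integrate an $\alpha$-profile backward from it until it meets a previously generated $\beta$-profile (or, failing that, leaves the admissible region), integrate a new $\beta$-profile forward from it, and repeat. When $s_e$ is reached or no switch point is left, integrate an $\alpha$-profile backward from $(s_e,\dot s_e)$ in the same way. The method *finds a feasible trajectory* $T$ if the generated profiles connect $(0,\dot s_0)$ with $(s_e,\dot s_e)$ along $T$ (follow a $\beta$-profile to the point where an $\alpha$-profile met it, follow the latter to the point from which it was integrated, continue with the $\beta$-profile of that point, and so on), and $T$ is feasible: it is continuous on $[0,s_e]$,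 has the prescribed end velocities, stays in the admissible region and satisfies the torque constraints except at finitely many corners. **Theorem.** Let $T$ be the trajectory that NI finds with limit curve $MVC$ (torque constraints only). Let $V:[0,s_e]\to\mathbb R$ be a velocity limit, $MVC^*=\min(MVC,V)$, and let $MVC^\dagger$ be the part of the curve $MVC^*$ over $\{s\in[0,s_e]:MVC^*(s)<MVC(s)\}$. Suppose that * $(C_1)$ there is $s^*\in[0,s_e]$ with $MVC^*(s^*)<T(s^*)$; * $(C_2)$ no point of $MVC^\dagger$ is a discontinuity or zero-inertia switch point of $MVC^*$. Then the NI method with limit curve $MVC^*$ does not find a feasible trajectory. Moreover, in every run of it and for every $s^*\in[0,s_e]$ with $MVC^*(s^*)<T(s^*)$, no generated $\beta$-profile that starts at a path coordinate less than $s^*$ meets, in the admissible region under $MVC^*$, a generated $\alpha$-profile that is integrated backward from a path coordinate greater than $s^*$. -/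

import Mathlib

open Set Topology

noncomputable section

namespace NumInt

/-- The data of a path-constrained trajectory planning problem with torque constraints
`A i s * s'' + B i s * s' ^ 2 + C i s ≤ 0`, `i = 1, …, m`, along a path of length `se`, with
prescribed path velocities `v0` at `s = 0` and `ve` at `s = se`. -/
structure PathProblem (m : ℕ) where
  se : ℝ
  v0 : ℝ
  ve : ℝ
  A : Fin m → ℝ → ℝ
  B : Fin m → ℝ → ℝ
  C : Fin m → ℝ → ℝ

variable {m : ℕ}

namespace PathProblem

variable (P : PathProblem m)

/-- Minimum path acceleration at the path coordinate `s` and path velocity `v`: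
the maximum of the finitely many lower bounds given by the rows with `A i s < 0`. -/
def alpha (s v : ℝ) : ℝ :=
  sSup {a : ℝ | ∃ i, P.A i s < 0 ∧ a = (-P.B i s * v ^ 2 - P.C i s) / P.A i s}

/-- Maximum path acceleration: the minimum of the finitely many upper bounds given by the rows
with `0 < A i s`. -/
def beta (s v : ℝ) : ℝ :=
  sInf {b : ℝ | ∃ i, 0 < P.A i s ∧ b = (-P.B i s * v ^ 2 - P.C i s) / P.A i s}

/-- Slope `dv/ds` of an `α`-profile. -/
def kAlpha (s v : ℝ) : ℝ := P.alpha s v / v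

/-- Slope `dv/ds` of a `β`-profile. -/
def kBeta (s v : ℝ) : ℝ := P.beta s v / v

/-- The state `(s, v)` saturates the torque constraints: no freedom is left for the acceleration,
or a row with `A i s = 0`, which bounds the velocity and not the acceleration, is active. -/
def Saturated (s v : ℝ) : Prop :=
  P.alpha s v = P.beta s v ∨ ∃ i, P.A i s = 0 ∧ P.B i s * v ^ 2 + P.C i s = 0

/-- The maximum velocity curve of the torque constraints. -/
def mvc (s : ℝ) : ℝ := sInf {v : ℝ | 0 ≤ v ∧ P.Saturated s v}

/-- The maximum velocity curve altered by the velocity limit `V`. -/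
def mvcStar (V : ℝ → ℝ) (s : ℝ) : ℝ := min (P.mvc s) (V s)

/-- The part of the curve `mvcStar` that differs from `mvc`. -/
def mvcDagger (V : ℝ → ℝ) : Set (ℝ × ℝ) :=
  {p | p.1 ∈ Icc 0 P.se ∧ p.2 = P.mvcStar V p.1 ∧ P.mvcStar V p.1 < P.mvc p.1}

/-- Standing assumptions on the data. The coefficients are bounded on the path (as they are when
they are piecewise continuous); both acceleration bounds and the maximum velocity curve exist over
every point of the path; and at zero path velocity, the bottom of the admissible region, some
bounded acceleration satisfies all torque constraints strictly, with a margin uniform along the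
path. -/
structure WellPosed : Prop where
  se_pos : 0 < P.se
  bounded : ∃ K : ℝ, ∀ i, ∀ s ∈ Icc 0 P.se, |P.A i s| ≤ K ∧ |P.B i s| ≤ K ∧ |P.C i s| ≤ K
  lower_row : ∀ s ∈ Icc 0 P.se, ∃ i, P.A i s < 0
  upper_row : ∀ s ∈ Icc 0 P.se, ∃ i, 0 < P.A i s
  mvc_exists : ∀ s ∈ Icc 0 P.se, ∃ v : ℝ, 0 ≤ v ∧ P.Saturated s v
  strict_at_rest : ∃ ε > (0 : ℝ), ∃ M : ℝ, ∀ s ∈ Icc 0 P.se,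
    ∃ a : ℝ, |a| ≤ M ∧ ∀ i, P.A i s * a + P.C i s ≤ -ε

/-! ### Switch points on a limit curve `L` -/

/-- The slope of `L` at `s` is that of the `α`-profile and of the `β`-profile. -/
def IsTangentPoint (L : ℝ → ℝ) (s : ℝ) : Prop :=
  0 < L s ∧ HasDerivWithinAt L (P.kAlpha s (L s)) (Icc 0 P.se) s ∧
    P.kAlpha s (L s) = P.kBeta s (L s)

def IsDiscontinuityPoint (L : ℝ → ℝ) (s : ℝ) : Prop :=
  ¬ ContinuousWithinAt L (Icc 0 P.se) s

def IsZeroInertiaPoint (s : ℝ) : Prop := ∃ i, P.A i s = 0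

/-- `(s, L s)` is a switch point, from decelerating to accelerating, on the curve `L`. -/
def IsSwitchPoint (L : ℝ → ℝ) (s : ℝ) : Prop :=
  s ∈ Icc 0 P.se ∧
    (P.IsTangentPoint L s ∨ P.IsDiscontinuityPoint L s ∨ P.IsZeroInertiaPoint s)

/-! ### Profiles -/

/-- The admissible region enclosed by `L` and the lines `v = 0`, `s = 0`, `s = se`. -/
def AdmissibleRegion (L : ℝ → ℝ) : Set (ℝ × ℝ) :=
  {p | p.1 ∈ Icc 0 P.se ∧ 0 ≤ p.2 ∧ p.2 ≤ L p.1}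

/-- The points on or above the limit curve; the closure adds the vertical segments at its jumps. -/
def Barrier (L : ℝ → ℝ) : Set (ℝ × ℝ) :=
  closure {p | p.1 ∈ Icc 0 P.se ∧ L p.1 ≤ p.2}

/-- `v` is on `[s₀, s₁]` an accelerating curve (slope `kBeta`, up to finitely many corners) that
starts at `(s₀, v₀)` and does not meet `L` nor the line of zero velocity strictly between
`s₀` and `s₁`. -/
structure IsBetaArc (L : ℝ → ℝ) (v : ℝ → ℝ) (s₀ v₀ s₁ : ℝ) : Prop where
  le : s₀ ≤ s₁
  le_se : s₁ ≤ P.se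
  cont : ContinuousOn v (Icc s₀ s₁)
  start : v s₀ = v₀
  inside : ∀ s ∈ Ioo s₀ s₁, 0 < v s ∧ (s, v s) ∉ P.Barrier L
  deriv : ∃ F : Finset ℝ, ∀ s ∈ Ioo s₀ s₁, s ∉ F → HasDerivAt v (P.kBeta s (v s)) s

/-- The `β`-profile integrated forward from `(s₀, v₀)`, which ends at `s₁`: it goes as far as
possible, that is, until it hits `L`, the line of zero velocity, or the line `s = se`. -/
def IsBetaProfile (L : ℝ → ℝ) (v : ℝ → ℝ) (s₀ v₀ s₁ : ℝ) : Prop :=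
  P.IsBetaArc L v s₀ v₀ s₁ ∧ ∀ s₁' > s₁, ∀ v' : ℝ → ℝ, ¬ P.IsBetaArc L v' s₀ v₀ s₁'

/-- `v` is on `[s₀, s₁]` a decelerating curve (slope `kAlpha`, up to finitely many corners) that
ends at `(s₁, v₁)` and does not meet `L` nor the line of zero velocity strictly between
`s₀` and `s₁`. -/
structure IsAlphaArc (L : ℝ → ℝ) (v : ℝ → ℝ) (s₁ v₁ s₀ : ℝ) : Prop where
  le : s₀ ≤ s₁
  nonneg : 0 ≤ s₀
  cont : ContinuousOn v (Icc s₀ s₁)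
  start : v s₁ = v₁
  inside : ∀ s ∈ Ioo s₀ s₁, 0 < v s ∧ (s, v s) ∉ P.Barrier L
  deriv : ∃ F : Finset ℝ, ∀ s ∈ Ioo s₀ s₁, s ∉ F → HasDerivAt v (P.kAlpha s (v s)) s

/-- The `α`-profile integrated backward from `(s₁, v₁)`, which ends at `s₀`: it stops as soon as it
meets the set `G` of points of the `β`-profiles generated before; if it never does, it goes as far
as possible, that is, until it hits `L`, the line of zero velocity, or the line `s = 0`. -/
def IsAlphaProfile (L : ℝ → ℝ) (G : Set (ℝ × ℝ)) (v : ℝ → ℝ) (s₁ v₁ s₀ : ℝ) : Prop :=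
  P.IsAlphaArc L v s₁ v₁ s₀ ∧ (∀ s ∈ Ioc s₀ s₁, (s, v s) ∉ G) ∧
    ((s₀, v s₀) ∈ G ∨ ∀ s₀' < s₀, ∀ v' : ℝ → ℝ, ¬ P.IsAlphaArc L v' s₁ v₁ s₀')

/-- `T` is a feasible trajectory: a continuous velocity profile over the whole path with the
prescribed end velocities, that stays in the admissible region under `L` and satisfies the torque
constraints (`T s * d` is the path acceleration), up to finitely many corners. -/
structure Feasible (L : ℝ → ℝ) (T : ℝ → ℝ) : Prop where
  cont : ContinuousOn T (Icc 0 P.se)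
  start : T 0 = P.v0
  terminal : T P.se = P.ve
  admissible : ∀ s ∈ Icc 0 P.se, (s, T s) ∈ P.AdmissibleRegion L
  torque : ∃ F : Finset ℝ, ∀ s ∈ Ioo 0 P.se, s ∉ F → ∃ d : ℝ, HasDerivAt T d s ∧
    ∀ i, P.A i s * (T s * d) + P.B i s * T s ^ 2 + P.C i s ≤ 0

end PathProblem

/-- A run of the numerical integration method with limit curve `L`.
The points `(q k, w k)` are the starting point (`k = 0`), the switch points found (`1 ≤ k ≤ n`) and
the terminal point (`k = n + 1`). From the `k`-th point, `k ≤ n`, the `β`-profile `b k` is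
integrated forward up to the coordinate `h k`; from the `k`-th point, `1 ≤ k`, the `α`-profile
`a k` is integrated backward down to the coordinate `l k`. -/
structure NIRun (P : PathProblem m) (L : ℝ → ℝ) where
  n : ℕ
  q : ℕ → ℝ
  w : ℕ → ℝ
  b : ℕ → ℝ → ℝ
  h : ℕ → ℝ
  a : ℕ → ℝ → ℝ
  l : ℕ → ℝ
  q_zero : q 0 = 0
  w_zero : w 0 = P.v0
  q_last : q (n + 1) = P.se
  w_last : w (n + 1) = P.ve
  beta_profile : ∀ k ≤ n, P.IsBetaProfile L (b k) (q k) (w k) (h k)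
  /-- The `k`-th `β`-profile hits `L`, and the next point is the first switch point found on `L`
  when searching forward from the hitting point. -/
  search : ∀ k < n, h k < P.se ∧ 0 < b k (h k) ∧
    IsLeast {s : ℝ | h k ≤ s ∧ q k < s ∧ P.IsSwitchPoint L s} (q (k + 1)) ∧
    w (k + 1) = L (q (k + 1))
  /-- The search ends when a `β`-profile reaches the end of the path, or hits `L` with no switch
  point left. (If the line of zero velocity is hit, the path is not traversable.) -/
  search_end : h n = P.se ∨
    (0 < b n (h n) ∧ ∀ s : ℝ, h n ≤ s → q n < s → ¬ P.IsSwitchPoint L s)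
  alpha_profile : ∀ k, 1 ≤ k → k ≤ n + 1 →
    P.IsAlphaProfile L {p | ∃ i < k, p.1 ∈ Icc (q i) (h i) ∧ p.2 = b i p.1}
      (a k) (q k) (w k) (l k)

/-- The generated profiles connect the starting point with the `k`-th point of the run along `T`:
follow a `β`-profile until it is met by an `α`-profile, follow the latter to the point from which
it was integrated, go on with the `β`-profile of that point, and so on. -/
inductive NIRun.Connects {P : PathProblem m} {L : ℝ → ℝ} (R : NIRun P L) (T : ℝ → ℝ) : ℕ → Prop
  | start : NIRun.Connects R T 0
  | step (i k : ℕ) (hik : i < k) (hk : k ≤ R.n + 1) (hi : NIRun.Connects R T i)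
      (mem : R.l k ∈ Icc (R.q i) (R.h i)) (meet : R.a k (R.l k) = R.b i (R.l k))
      (accelerate : ∀ s ∈ Icc (R.q i) (R.l k), T s = R.b i s)
      (decelerate : ∀ s ∈ Icc (R.l k) (R.q k), T s = R.a k s) : NIRun.Connects R T k

/-- The method run with the limit curve `L` finds the feasible trajectory `T`: the generated
profiles connect the starting point with the terminal point along `T`, and `T` is feasible. -/
def NIFinds (P : PathProblem m) (L : ℝ → ℝ) (T : ℝ → ℝ) : Prop :=
  (∃ R : NIRun P L, R.Connects T (R.n + 1)) ∧ P.Feasible L T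

end NumInt

end

/-!
The proof compares squared velocities. Write `x = v ^ 2`; then `dx/ds` is twice the path
acceleration, and the torque constraints are affine in `x` and in the acceleration. Since some
bounded acceleration is strictly feasible at rest, the bound `β` (as a function of `x`) is
one-sided Lipschitz in a form that can be integrated, even where coefficients `A i` tend to zero and
`β` is unbounded: this is `AccelBound`, and `sq_le_of_accelBound` is the resulting comparison
principle. It says that a feasible trajectory that starts on or below a `β`-profile stays on or
below it (`IsBetaArc.lt_start`, in contrapositive form), and, with the path reversed, that a feasible
trajectory that ends on or below an `α`-profile lies on or below it before
(`IsAlphaArc.lt_start`).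

Let `T` be the trajectory found under `mvc`. A switch point of `mvcStar` at which
`mvcStar < mvc` would have to be a tangent point by `hC2`, but there `α = β`, so that the torque
constraints are saturated strictly below `mvc`, which is absurd. Hence `T ≤ mvc = mvcStar` at every
switch point of `mvcStar`, and all profiles of a run under `mvcStar` are integrated from points on or
above `T` (`NIRun.le_w`). If a `β`-profile from the left of `sStar` and an `α`-profile from the right
of `sStar` met in the admissible region, one of them would pass over `sStar` at or below
`mvcStar sStar < T sStar`, and by the comparison principle it would have been integrated from a point
strictly below `T`. A feasible trajectory under `mvcStar` would contain such a meeting point.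
-/

open Set Topology

namespace NumInt

/-! ### A comparison principle for squared velocities -/

/-- The relation between a state with squared velocity `x` and acceleration `q` at which the
constraint row `A * q + B * x + C ≤ 0`, `0 < A`, is active, and a state with squared velocity `y`
and acceleration `p` which satisfies that row, when the acceleration `a` satisfies it at rest with
margin `ε`. -/
def AccelBound (K M ε x y p q : ℝ) : Prop :=
  ∃ A B C a : ℝ, 0 < A ∧ |B| ≤ K ∧ |a| ≤ M ∧ A * q + B * x + C = 0 ∧
    A * p + B * y + C ≤ 0 ∧ A * a + C ≤ -ε

/-- The bound on the growth of `y / x`, for use away from rest. -/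
theorem AccelBound.mul_sub_mul_le {K M ε x y p q : ℝ} (h : AccelBound K M ε x y p q)
    (hε : 0 < ε) (hx : 0 ≤ x) (hxy : x ≤ y) : p * x - q * y ≤ M * (y - x) := by
  obtain ⟨A, B, C, a, hA, -, ha, hq, hp, hr⟩ := h
  have h1 : A * (p - q) ≤ -B * (y - x) := by linarith
  have h2 : -B * x ≤ A * (q - a) := by linarith
  have h3 : A * ((p - q) * x) ≤ A * ((q - a) * (y - x)) := by
    nlinarith [mul_le_mul_of_nonneg_right h1 hx,
      mul_le_mul_of_nonneg_right h2 (sub_nonneg.2 hxy)]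
  have h4 := le_of_mul_le_mul_left h3 hA
  nlinarith [mul_le_mul_of_nonneg_right (neg_le_of_abs_le ha) (sub_nonneg.2 hxy)]

/-- The bound on the growth of `y - x`, for use near rest. -/
theorem AccelBound.sub_le {K M ε x y p q : ℝ} (h : AccelBound K M ε x y p q)
    (hε : 0 < ε) (hx : 0 ≤ x) (hx' : K * x ≤ ε / 2) (hxy : x ≤ y) :
    p - q ≤ 2 * K / ε * (q + M) * (y - x) := by
  obtain ⟨A, B, C, a, hA, hB, ha, hq, hp, hr⟩ := h
  have hK : 0 ≤ K := (abs_nonneg B).trans hB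
  have h1 : A * (p - q) ≤ K * (y - x) := by
    nlinarith [mul_le_mul_of_nonneg_right (neg_le_of_abs_le hB) (sub_nonneg.2 hxy)]
  have h2 : ε / 2 ≤ A * (q + M) := by
    nlinarith [mul_le_mul_of_nonneg_right (le_of_abs_le hB) hx,
      mul_le_mul_of_nonneg_left (neg_le_of_abs_le ha) hA.le]
  have h3 : K * (y - x) ≤ A * (2 * K / ε * (q + M) * (y - x)) := by
    have : A * (2 * K / ε * (q + M) * (y - x)) = K * (y - x) * (2 / ε * (A * (q + M))) := by ring
    rw [this]
    refine le_mul_of_one_le_right (mul_nonneg hK (sub_nonneg.2 hxy)) ?_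
    calc (1 : ℝ) = 2 / ε * (ε / 2) := by field_simp
      _ ≤ _ := by gcongr
  exact le_of_mul_le_mul_left (h1.trans h3) hA

/-- A continuous function with nonpositive derivative does not increase. -/
theorem image_le_of_hasDerivAt_nonpos {g g' : ℝ → ℝ} {a b : ℝ} (hab : a ≤ b)
    (hg : ContinuousOn g (Icc a b)) (hd : ∀ t ∈ Ioo a b, HasDerivAt g (g' t) t)
    (hn : ∀ t ∈ Ioo a b, g' t ≤ 0) : g b ≤ g a := by
  refine antitoneOn_of_deriv_nonpos (convex_Icc a b) hg ?_ ?_ (left_mem_Icc.2 hab)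
    (right_mem_Icc.2 hab) hab
  · rw [interior_Icc]
    exact fun t ht => (hd t ht).differentiableAt.differentiableWithinAt
  · rw [interior_Icc]
    exact fun t ht => (hd t ht).deriv ▸ hn t ht

/-- Local form of the comparison principle away from rest: `y / x - 1` obeys a linear differential
inequality. -/
theorem le_of_accelBound_of_pos {K M ε : ℝ} (hε : 0 < ε) (hM : 0 ≤ M) {x y p q : ℝ → ℝ}
    {a b : ℝ} (hab : a ≤ b) (hxc : ContinuousOn x (Icc a b)) (hyc : ContinuousOn y (Icc a b))
    (hx0 : ∀ t ∈ Icc a b, 0 < x t) (hxy : ∀ t ∈ Ioo a b, x t ≤ y t)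
    (hyd : ∀ t ∈ Ioo a b, HasDerivAt y (2 * p t) t)
    (hxd : ∀ t ∈ Ioo a b, HasDerivAt x (2 * q t) t)
    (hB : ∀ t ∈ Ioo a b, AccelBound K M ε (x t) (y t) (p t) (q t))
    (h0 : y a ≤ x a) : y b ≤ x b := by
  obtain ⟨c, hc, hmin⟩ := isCompact_Icc.exists_isMinOn (nonempty_Icc.2 hab) hxc
  have hδ : 0 < x c := hx0 c hc
  set k : ℝ := 2 * M / x c with hk
  have key := image_le_of_hasDerivAt_nonpos (g := fun t => (y t / x t - 1) * Real.exp (-(k * t)))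
    (g' := fun t => ((2 * p t * x t - y t * (2 * q t)) / x t ^ 2) * Real.exp (-(k * t)) +
      (y t / x t - 1) * (Real.exp (-(k * t)) * (-(k * 1)))) hab ?_ ?_ ?_
  · have ha := hx0 a (left_mem_Icc.2 hab)
    have hb := hx0 b (right_mem_Icc.2 hab)
    have h1 : (y a / x a - 1) * Real.exp (-(k * a)) ≤ 0 :=
      mul_nonpos_of_nonpos_of_nonneg (sub_nonpos.2 ((div_le_one ha).2 h0)) (Real.exp_pos _).le
    have h2 : (y b / x b - 1) ≤ 0 :=
      nonpos_of_mul_nonpos_left (key.trans h1) (Real.exp_pos _)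
    exact (div_le_one hb).1 (sub_nonpos.1 h2)
  · exact ((hyc.div hxc fun t ht => (hx0 t ht).ne').sub continuousOn_const).mul
      (by fun_prop)
  · intro t ht
    have hxt := hx0 t (Ioo_subset_Icc_self ht)
    exact (((hyd t ht).div (hxd t ht) hxt.ne').sub_const 1).mul
      (((hasDerivAt_id t).const_mul k).neg.exp)
  · intro t ht
    have hxt := hx0 t (Ioo_subset_Icc_self ht)
    have h1 := (hB t ht).mul_sub_mul_le hε hxt.le (hxy t ht)
    have h2 : x c ≤ x t := hmin (Ioo_subset_Icc_self ht)
    have h3 : (2 * p t * x t - y t * (2 * q t)) / x t ^ 2 ≤ k * (y t / x t - 1) := by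
      rw [div_le_iff₀ (by positivity)]
      have h4 : k * (y t / x t - 1) * x t ^ 2 = 2 * M * (y t - x t) * (x t / x c) := by
        rw [hk]; field_simp
      rw [h4]
      have h5 : 2 * M * (y t - x t) ≤ 2 * M * (y t - x t) * (x t / x c) :=
        le_mul_of_one_le_right (mul_nonneg (by positivity) (sub_nonneg.2 (hxy t ht)))
          ((one_le_div hδ).2 h2)
      linarith
    have h6 := mul_le_mul_of_nonneg_right h3 (Real.exp_pos (-(k * t))).le
    linarith

/-- Local form of the comparison principle near rest: the coefficient `c * (q + M)` of the linear
differential inequality for `y - x` is half the derivative of `c * (x + 2 * M * t)`, so that it has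
an explicit integrating factor although `q` may be unbounded. -/
theorem le_of_accelBound_of_small {K M ε : ℝ} (hε : 0 < ε) {x y p q : ℝ → ℝ}
    {a b : ℝ} (hab : a ≤ b) (hxc : ContinuousOn x (Icc a b)) (hyc : ContinuousOn y (Icc a b))
    (hx0 : ∀ t ∈ Ioo a b, 0 ≤ x t) (hxs : ∀ t ∈ Ioo a b, K * x t ≤ ε / 2)
    (hxy : ∀ t ∈ Ioo a b, x t ≤ y t)
    (hyd : ∀ t ∈ Ioo a b, HasDerivAt y (2 * p t) t)
    (hxd : ∀ t ∈ Ioo a b, HasDerivAt x (2 * q t) t)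
    (hB : ∀ t ∈ Ioo a b, AccelBound K M ε (x t) (y t) (p t) (q t))
    (h0 : y a ≤ x a) : y b ≤ x b := by
  set c : ℝ := 2 * K / ε
  have key := image_le_of_hasDerivAt_nonpos
    (g := fun t => (y t - x t) * Real.exp (-(c * (x t + 2 * M * t))))
    (g' := fun t => (2 * p t - 2 * q t) * Real.exp (-(c * (x t + 2 * M * t))) +
      (y t - x t) * (Real.exp (-(c * (x t + 2 * M * t))) * (-(c * (2 * q t + 2 * M * 1)))))
    hab ?_ ?_ ?_
  · have h1 : (y a - x a) * Real.exp (-(c * (x a + 2 * M * a))) ≤ 0 :=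
      mul_nonpos_of_nonpos_of_nonneg (sub_nonpos.2 h0) (Real.exp_pos _).le
    exact sub_nonpos.1 (nonpos_of_mul_nonpos_left (key.trans h1) (Real.exp_pos _))
  · fun_prop
  · intro t ht
    exact ((hyd t ht).sub (hxd t ht)).mul
      ((((hxd t ht).add ((hasDerivAt_id t).const_mul (2 * M))).const_mul c).neg.exp)
  · intro t ht
    have h1 := (hB t ht).sub_le hε (hx0 t ht) (hxs t ht) (hxy t ht)
    have h6 := mul_le_mul_of_nonneg_right h1 (Real.exp_pos (-(c * (x t + 2 * M * t)))).le
    simp only [mul_one]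
    linarith

/-- The comparison principle: while `AccelBound` holds, up to finitely many corners, a curve `y`
that starts on or below `x` stays on or below it. -/
theorem sq_le_of_accelBound {K M ε : ℝ} (hε : 0 < ε) (hM : 0 ≤ M) {x y p q : ℝ → ℝ}
    {a b : ℝ} (hab : a ≤ b) (hxc : ContinuousOn x (Icc a b)) (hyc : ContinuousOn y (Icc a b))
    (hx0 : ∀ t ∈ Ioo a b, 0 < x t) (F : Finset ℝ)
    (hd : ∀ t ∈ Ioo a b, t ∉ F → HasDerivAt y (2 * p t) t ∧ HasDerivAt x (2 * q t) t ∧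
      AccelBound K M ε (x t) (y t) (p t) (q t))
    (h0 : y a ≤ x a) : y b ≤ x b := by
  by_contra! hb
  -- `c` is the last point at which `y ≤ x`.
  have hcomp : IsCompact {t ∈ Icc a b | y t ≤ x t} := by
    have : IsClosed {t ∈ Icc a b | y t ≤ x t} := by
      have h := (hyc.prodMk hxc).preimage_isClosed_of_isClosed isClosed_Icc
        (isClosed_le continuous_fst continuous_snd)
      exact h
    exact isCompact_Icc.of_isClosed_subset this fun t ht => ht.1
  obtain ⟨c, ⟨⟨hac, hcb⟩, hc⟩, hmax⟩ := hcomp.exists_isGreatest ⟨a, left_mem_Icc.2 hab, h0⟩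
  have hcb' : c < b := lt_of_le_of_ne hcb (by rintro rfl; exact absurd hc hb.not_ge)
  have hlt : ∀ t ∈ Ioc c b, x t < y t := fun t ht => by
    by_contra! h
    exact absurd (hmax ⟨⟨hac.trans ht.1.le, ht.2⟩, h⟩) ht.1.not_ge
  have hsub : Icc c b ⊆ Icc a b := Icc_subset_Icc_left hac
  have hxcc : ContinuousWithinAt x (Icc c b) c :=
    (hxc.mono hsub) c (left_mem_Icc.2 hcb)
  -- Immediately to the right of `c` there are no corners.
  have hF : ∀ᶠ t in 𝓝[>] c, t ∉ F := by
    have h : ∀ᶠ t in 𝓝 c, t ∉ F.erase c :=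
      (F.erase c).finite_toSet.isClosed.isOpen_compl.mem_nhds (by simp)
    filter_upwards [nhdsWithin_le_nhds h, self_mem_nhdsWithin] with t ht htc htF
    exact ht (Finset.mem_erase.2 ⟨(mem_Ioi.1 htc).ne', htF⟩)
  have hnb : 𝓝[>] c ≤ 𝓝[Icc c b] c := by
    rw [← nhdsWithin_Ioo_eq_nhdsGT hcb']
    exact nhdsWithin_mono _ Ioo_subset_Icc_self
  have hxlim : Filter.Tendsto x (𝓝[>] c) (𝓝 (x c)) := hxcc.mono_left hnb
  have hshort : ∀ d ∈ Ioo c b, (∀ t ∈ Ioc c d, t ∉ F) → ∀ t ∈ Ioo c d,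
      HasDerivAt y (2 * p t) t ∧ HasDerivAt x (2 * q t) t ∧
      AccelBound K M ε (x t) (y t) (p t) (q t) := fun d hdb h t ht =>
    hd t ⟨hac.trans_lt ht.1, ht.2.trans hdb.2⟩ (h t ⟨ht.1, ht.2.le⟩)
  have hpos : ∀ t ∈ Ioo c b, 0 < x t := fun t ht => hx0 t ⟨hac.trans_lt ht.1, ht.2⟩
  have hxc0 : 0 ≤ x c := by
    refine ge_of_tendsto hxlim ?_
    filter_upwards [Ioo_mem_nhdsGT hcb'] with t ht using (hpos t ht).le
  rcases hxc0.lt_or_eq with hxc1 | hxc1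
  · obtain ⟨d, hdc, hdF⟩ := (mem_nhdsGT_iff_exists_mem_Ioc_Ioo_subset hcb').1 hF
    obtain ⟨e, hce, hed⟩ := exists_between hdc.1
    have heb : e ∈ Ioo c b := ⟨hce, hed.trans_le hdc.2⟩
    have hs := hshort e heb fun t ht => hdF ⟨ht.1, ht.2.trans_lt hed⟩
    have hIcc : Icc c e ⊆ Icc a b := (Icc_subset_Icc_right heb.2.le).trans hsub
    refine (hlt e ⟨hce, heb.2.le⟩).not_ge
      (le_of_accelBound_of_pos hε hM hce.le (hxc.mono hIcc) (hyc.mono hIcc) (fun t ht => ?_)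
        (fun t ht => (hlt t ⟨ht.1, (ht.2.trans heb.2).le⟩).le) (fun t ht => (hs t ht).1)
        (fun t ht => (hs t ht).2.1) (fun t ht => (hs t ht).2.2) hc)
    rcases ht.1.eq_or_lt with rfl | h
    · exact hxc1
    · exact hpos t ⟨h, ht.2.trans_lt heb.2⟩
  · have hsm : ∀ᶠ t in 𝓝[>] c, K * x t < ε / 2 := by
      refine (hxlim.const_mul K).eventually_lt_const ?_
      rw [← hxc1, mul_zero]
      positivity
    obtain ⟨d, hdc, hdF⟩ := (mem_nhdsGT_iff_exists_mem_Ioc_Ioo_subset hcb').1 (hF.and hsm)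
    obtain ⟨e, hce, hed⟩ := exists_between hdc.1
    have heb : e ∈ Ioo c b := ⟨hce, hed.trans_le hdc.2⟩
    have hs := hshort e heb fun t ht => (hdF ⟨ht.1, ht.2.trans_lt hed⟩).1
    have hIcc : Icc c e ⊆ Icc a b := (Icc_subset_Icc_right heb.2.le).trans hsub
    exact (hlt e ⟨hce, heb.2.le⟩).not_ge
      (le_of_accelBound_of_small hε hce.le (hxc.mono hIcc) (hyc.mono hIcc)
        (fun t ht => (hpos t ⟨ht.1, ht.2.trans heb.2⟩).le)
        (fun t ht => (hdF ⟨ht.1, ht.2.trans hed⟩).2.le)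
        (fun t ht => (hlt t ⟨ht.1, (ht.2.trans heb.2).le⟩).le) (fun t ht => (hs t ht).1)
        (fun t ht => (hs t ht).2.1) (fun t ht => (hs t ht).2.2) hc)

theorem nonneg_of_pos_Ioo {f : ℝ → ℝ} {a b : ℝ} (hab : a < b) (hf : ContinuousOn f (Icc a b))
    (h : ∀ t ∈ Ioo a b, 0 < f t) : ∀ t ∈ Icc a b, 0 ≤ f t := by
  intro t ht
  rw [← closure_Ioo hab.ne] at hf ht
  exact le_on_closure (fun t ht => (h t ht).le) continuousOn_const hf ht

namespace PathProblem

variable {m : ℕ} {P : PathProblem m}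

/-! ### Feasible trajectories and profiles -/

theorem exists_row_beta {s : ℝ} (h : ∃ i, 0 < P.A i s) (v : ℝ) :
    ∃ j, 0 < P.A j s ∧ P.A j s * P.beta s v + P.B j s * v ^ 2 + P.C j s = 0 := by
  have hfin : {b : ℝ | ∃ i, 0 < P.A i s ∧ b = (-P.B i s * v ^ 2 - P.C i s) / P.A i s}.Finite :=
    (Set.finite_range fun i => (-P.B i s * v ^ 2 - P.C i s) / P.A i s).subset
      (by rintro _ ⟨i, -, rfl⟩; exact ⟨i, rfl⟩)
  obtain ⟨i, hi⟩ := h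
  have hne : Set.Nonempty {b : ℝ | ∃ i, 0 < P.A i s ∧ b = (-P.B i s * v ^ 2 - P.C i s) / P.A i s} :=
    ⟨_, i, hi, rfl⟩
  obtain ⟨j, hj, hjb⟩ := hne.csInf_mem hfin
  refine ⟨j, hj, ?_⟩
  rw [beta, hjb]
  field_simp
  ring

theorem exists_row_alpha {s : ℝ} (h : ∃ i, P.A i s < 0) (v : ℝ) :
    ∃ j, P.A j s < 0 ∧ P.A j s * P.alpha s v + P.B j s * v ^ 2 + P.C j s = 0 := by
  have hfin : {b : ℝ | ∃ i, P.A i s < 0 ∧ b = (-P.B i s * v ^ 2 - P.C i s) / P.A i s}.Finite :=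
    (Set.finite_range fun i => (-P.B i s * v ^ 2 - P.C i s) / P.A i s).subset
      (by rintro _ ⟨i, -, rfl⟩; exact ⟨i, rfl⟩)
  obtain ⟨i, hi⟩ := h
  have hne : Set.Nonempty {b : ℝ | ∃ i, P.A i s < 0 ∧ b = (-P.B i s * v ^ 2 - P.C i s) / P.A i s} :=
    ⟨_, i, hi, rfl⟩
  obtain ⟨j, hj, hjb⟩ := hne.csSup_mem hfin
  refine ⟨j, hj, ?_⟩
  rw [alpha, hjb]
  have := hj.ne
  field_simp
  ring

theorem WellPosed.exists_bounds (hP : P.WellPosed) : ∃ K M ε : ℝ, 0 < ε ∧ 0 ≤ M ∧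
    (∀ i, ∀ s ∈ Icc 0 P.se, |P.B i s| ≤ K) ∧
    ∀ s ∈ Icc 0 P.se, ∃ a : ℝ, |a| ≤ M ∧ ∀ i, P.A i s * a + P.C i s ≤ -ε := by
  obtain ⟨K, hK⟩ := hP.bounded
  obtain ⟨ε, hε, M, hM⟩ := hP.strict_at_rest
  obtain ⟨a, ha, -⟩ := hM 0 (left_mem_Icc.2 hP.se_pos.le)
  exact ⟨K, M, ε, hε, (abs_nonneg a).trans ha, fun i s hs => (hK i s hs).2.1, hM⟩

theorem hasDerivAt_sq {f : ℝ → ℝ} {d t : ℝ} (h : HasDerivAt f d t) :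
    HasDerivAt (fun s => f s ^ 2) (2 * (f t * d)) t := by
  refine (h.fun_pow 2).congr_deriv ?_
  push_cast
  ring

/-- A `β`-profile that is below a feasible trajectory somewhere has started below it. -/
theorem IsBetaArc.lt_start (hP : P.WellPosed) {L L' T b : ℝ → ℝ} {s₀ v₀ s₁ s : ℝ}
    (hb : P.IsBetaArc L b s₀ v₀ s₁) (hT : P.Feasible L' T) (h0 : 0 ≤ s₀) (hs₀ : s₀ < s)
    (hs₁ : s ≤ s₁) (hlt : b s < T s) : v₀ < T s₀ := by
  obtain ⟨K, M, ε, hε, hM, hK, hrest⟩ := hP.exists_bounds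
  obtain ⟨F, hF⟩ := hb.deriv
  obtain ⟨G, hG⟩ := hT.torque
  have hT0 : ∀ t ∈ Icc 0 P.se, 0 ≤ T t := fun t ht => (hT.admissible t ht).2.1
  have hbs : 0 ≤ b s := nonneg_of_pos_Ioo (hs₀.trans_le hs₁) hb.cont
    (fun t ht => (hb.inside t ht).1) s ⟨hs₀.le, hs₁⟩
  rw [← hb.start]
  by_contra! hle
  have hse : s ≤ P.se := hs₁.trans hb.le_se
  have key := sq_le_of_accelBound (K := K) (x := fun t => b t ^ 2) (y := fun t => T t ^ 2)
    (p := fun t => T t * _root_.deriv T t) (q := fun t => P.beta t (b t)) hε hM hs₀.le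
    ((hb.cont.mono (Icc_subset_Icc_right hs₁)).pow 2)
    ((hT.cont.mono (Icc_subset_Icc h0 hse)).pow 2)
    (fun t ht => pow_pos (hb.inside t ⟨ht.1, ht.2.trans_le hs₁⟩).1 2) (F ∪ G) ?_ ?_
  · exact ((pow_lt_pow_left₀ hlt hbs two_ne_zero).not_ge) key
  · intro t ht htF
    rw [Finset.mem_union, not_or] at htF
    have htI : t ∈ Ioo 0 P.se := ⟨h0.trans_lt ht.1, ht.2.trans_le hse⟩
    have htc := Ioo_subset_Icc_self htI
    have ht' : t ∈ Ioo s₀ s₁ := ⟨ht.1, ht.2.trans_le hs₁⟩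
    obtain ⟨d, hd, htor⟩ := hG t htI htF.2
    obtain ⟨j, hj, hjb⟩ := exists_row_beta (hP.upper_row t htc) (b t)
    obtain ⟨a, ha, har⟩ := hrest t htc
    have hbt := (hb.inside t ht').1
    refine ⟨hasDerivAt_sq (hd.deriv.symm ▸ hd), ?_, P.A j t, P.B j t, P.C j t, a, hj, hK j t htc, ha,
      hjb, hd.deriv.symm ▸ htor j, har j⟩
    convert hasDerivAt_sq (hF t ht' htF.1) using 2
    rw [kBeta, mul_div_cancel₀ _ hbt.ne']
  · exact pow_le_pow_left₀ (hT0 s₀ ⟨h0, hs₀.le.trans hse⟩) hle 2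

/-- An `α`-profile that is below a feasible trajectory somewhere has been integrated backward from
a point below it. This is the comparison principle on the reversed path `t ↦ -t`. -/
theorem IsAlphaArc.lt_start (hP : P.WellPosed) {L L' T f : ℝ → ℝ} {s₁ v₁ s₀ s : ℝ}
    (hf : P.IsAlphaArc L f s₁ v₁ s₀) (hT : P.Feasible L' T) (h1 : s₁ ≤ P.se) (hs₀ : s₀ ≤ s)
    (hs₁ : s < s₁) (hlt : f s < T s) : v₁ < T s₁ := by
  obtain ⟨K, M, ε, hε, hM, hK, hrest⟩ := hP.exists_bounds
  obtain ⟨F, hF⟩ := hf.deriv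
  obtain ⟨G, hG⟩ := hT.torque
  have hT0 : ∀ t ∈ Icc 0 P.se, 0 ≤ T t := fun t ht => (hT.admissible t ht).2.1
  have hfs : 0 ≤ f s := nonneg_of_pos_Ioo (hs₀.trans_lt hs₁) hf.cont
    (fun t ht => (hf.inside t ht).1) s ⟨hs₀, hs₁.le⟩
  rw [← hf.start]
  by_contra! hle
  have h0 : 0 ≤ s := hf.nonneg.trans hs₀
  have hneg : MapsTo (fun t : ℝ => -t) (Icc (-s₁) (-s)) (Icc s s₁) :=
    fun t ht => ⟨le_neg.1 ht.2, neg_le.1 ht.1⟩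
  have key := sq_le_of_accelBound (K := K) (x := fun t => f (-t) ^ 2) (y := fun t => T (-t) ^ 2)
    (p := fun t => -(T (-t) * _root_.deriv T (-t))) (q := fun t => -P.alpha (-t) (f (-t))) hε hM
    (neg_le_neg hs₁.le)
    (((hf.cont.mono (Icc_subset_Icc_left hs₀)).comp continuousOn_neg hneg).pow 2)
    (((hT.cont.mono (Icc_subset_Icc h0 h1)).comp continuousOn_neg hneg).pow 2)
    (fun t ht => pow_pos (hf.inside (-t) ⟨hs₀.trans_lt (lt_neg.1 ht.2), neg_lt.1 ht.1⟩).1 2)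
    ((F ∪ G).image fun t => -t) ?_ ?_
  · simp only [neg_neg] at key
    exact ((pow_lt_pow_left₀ hlt hfs two_ne_zero).not_ge) key
  · intro t ht htF
    have htF' : -t ∉ F ∪ G := fun h => htF (Finset.mem_image.2 ⟨-t, h, neg_neg t⟩)
    rw [Finset.mem_union, not_or] at htF'
    have ht' : -t ∈ Ioo s₀ s₁ := ⟨hs₀.trans_lt (lt_neg.1 ht.2), neg_lt.1 ht.1⟩
    have htI : -t ∈ Ioo 0 P.se := ⟨hf.nonneg.trans_lt ht'.1, ht'.2.trans_le h1⟩
    have htc := Ioo_subset_Icc_self htI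
    obtain ⟨d, hd, htor⟩ := hG (-t) htI htF'.2
    obtain ⟨j, hj, hjb⟩ := exists_row_alpha (hP.lower_row (-t) htc) (f (-t))
    obtain ⟨a, ha, har⟩ := hrest (-t) htc
    have hft := (hf.inside (-t) ht').1
    have hrev : ∀ {g : ℝ → ℝ} {e : ℝ}, HasDerivAt g (2 * e) (-t) →
        HasDerivAt (fun r => g (-r)) (2 * -e) t := fun {g e} h =>
      (h.comp t (hasDerivAt_neg t)).congr_deriv (by ring)
    refine ⟨hrev (g := fun r => T r ^ 2) (hasDerivAt_sq (hd.deriv.symm ▸ hd)), ?_, -P.A j (-t), P.B j (-t), P.C j (-t), -a,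
      neg_pos.2 hj, hK j (-t) htc, by rwa [abs_neg], ?_, ?_, ?_⟩
    · refine hrev (g := fun r => f r ^ 2) ?_
      convert hasDerivAt_sq (hF (-t) ht' htF'.1) using 2
      rw [kAlpha, mul_div_cancel₀ _ hft.ne']
    · rw [neg_mul_neg]
      exact hjb
    · rw [neg_mul_neg]
      exact hd.deriv.symm ▸ htor j
    · rw [neg_mul_neg]
      exact har j
  · simp only [neg_neg]
    exact pow_le_pow_left₀ (hT0 s₁ ⟨h0.trans hs₁.le, h1⟩) hle 2

theorem lt_of_notMem_barrier {L : ℝ → ℝ} {s v : ℝ} (hs : s ∈ Icc 0 P.se)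
    (h : (s, v) ∉ P.Barrier L) : v < L s := by
  by_contra! hle
  exact h (subset_closure ⟨hs, hle⟩)

/-! ### Switch points under a velocity limit -/

/-- At a tangent point `α = β`, so the torque constraints are saturated there. -/
theorem IsTangentPoint.mvc_le {L : ℝ → ℝ} {s : ℝ} (h : P.IsTangentPoint L s) : P.mvc s ≤ L s := by
  obtain ⟨hpos, -, hk⟩ := h
  rw [kAlpha, kBeta, div_left_inj' hpos.ne'] at hk
  exact csInf_le ⟨0, fun v hv => hv.1⟩ ⟨hpos.le, Or.inl hk⟩

/-- Under `hC2`, all switch points of `mvcStar` lie on `mvc`. -/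
theorem IsSwitchPoint.mvc_le {V : ℝ → ℝ}
    (hC2 : ∀ s : ℝ, (s, P.mvcStar V s) ∈ P.mvcDagger V →
      ¬ P.IsDiscontinuityPoint (P.mvcStar V) s ∧ ¬ P.IsZeroInertiaPoint s)
    {s : ℝ} (hs : P.IsSwitchPoint (P.mvcStar V) s) : P.mvc s ≤ P.mvcStar V s := by
  by_contra! hlt
  obtain ⟨hd, hz⟩ := hC2 s ⟨hs.1, rfl, hlt⟩
  rcases hs.2 with h | h | h
  · exact hlt.not_ge h.mvc_le
  · exact hd h
  · exact hz h

end PathProblem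

/-! ### Runs under a velocity limit -/

namespace NIRun

variable {m : ℕ} {P : PathProblem m}

theorem isSwitchPoint {L : ℝ → ℝ} (R : NIRun P L) {k : ℕ} (h1 : 1 ≤ k) (hk : k ≤ R.n) :
    P.IsSwitchPoint L (R.q k) ∧ R.w k = L (R.q k) := by
  obtain ⟨j, rfl⟩ := Nat.exists_eq_add_of_le' h1
  obtain ⟨-, -, h, hw⟩ := R.search j (by omega)
  exact ⟨h.1.2.2, hw⟩

theorem q_mem_Icc {L : ℝ → ℝ} (R : NIRun P L) (hse : 0 ≤ P.se) {k : ℕ} (hk : k ≤ R.n + 1) :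
    R.q k ∈ Icc 0 P.se := by
  rcases Nat.eq_zero_or_pos k with rfl | h
  · rw [R.q_zero]
    exact left_mem_Icc.2 hse
  rcases hk.eq_or_lt with rfl | h'
  · rw [R.q_last]
    exact right_mem_Icc.2 hse
  · exact (R.isSwitchPoint h (by omega)).1.1

/-- The points from which the profiles of a run under `mvcStar` are integrated are on or above any
trajectory that is feasible under `mvc`. -/
theorem le_w {V T : ℝ → ℝ} (hse : 0 ≤ P.se) (hT : P.Feasible P.mvc T)
    (hC2 : ∀ s : ℝ, (s, P.mvcStar V s) ∈ P.mvcDagger V →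
      ¬ P.IsDiscontinuityPoint (P.mvcStar V) s ∧ ¬ P.IsZeroInertiaPoint s)
    (R : NIRun P (P.mvcStar V)) {k : ℕ} (hk : k ≤ R.n + 1) : T (R.q k) ≤ R.w k := by
  rcases Nat.eq_zero_or_pos k with rfl | h
  · rw [R.q_zero, R.w_zero, hT.start]
  rcases hk.eq_or_lt with rfl | h'
  · rw [R.q_last, R.w_last, hT.terminal]
  · obtain ⟨hsw, hw⟩ := R.isSwitchPoint h (by omega)
    rw [hw]
    exact (hT.admissible _ (R.q_mem_Icc hse hk)).2.2.trans (hsw.mvc_le hC2)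

/-- No `β`-profile from the left of `sStar` meets an `α`-profile from the right of `sStar` in the
admissible region under `mvcStar`. -/
theorem beta_ne_alpha (hP : P.WellPosed) {V T : ℝ → ℝ} (hT : P.Feasible P.mvc T)
    (hC2 : ∀ s : ℝ, (s, P.mvcStar V s) ∈ P.mvcDagger V →
      ¬ P.IsDiscontinuityPoint (P.mvcStar V) s ∧ ¬ P.IsZeroInertiaPoint s)
    (R : NIRun P (P.mvcStar V)) {sStar : ℝ} (hs : sStar ∈ Icc 0 P.se)
    (hlt : P.mvcStar V sStar < T sStar) {i k : ℕ} (hi : i ≤ R.n) (hk1 : 1 ≤ k)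
    (hk : k ≤ R.n + 1) (hqi : R.q i < sStar) (hqk : sStar < R.q k) {s : ℝ}
    (hsi : s ∈ Icc (R.q i) (R.h i)) (hsk : s ∈ Icc (R.l k) (R.q k))
    (hadm : (s, R.b i s) ∈ P.AdmissibleRegion (P.mvcStar V)) : R.b i s ≠ R.a k s := by
  intro heq
  have hb := (R.beta_profile i hi).1
  have ha := (R.alpha_profile k hk1 hk).1
  have hqi' := R.q_mem_Icc hP.se_pos.le (k := i) (by omega)
  have hqk' := R.q_mem_Icc hP.se_pos.le hk
  rcases le_or_gt sStar s with h | h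
  · have hbs : R.b i sStar ≤ P.mvcStar V sStar := by
      rcases h.eq_or_lt with rfl | h'
      · exact hadm.2.2
      · exact (PathProblem.lt_of_notMem_barrier hs
          (hb.inside sStar ⟨hqi, h'.trans_le hsi.2⟩).2).le
    exact (hb.lt_start hP hT hqi'.1 hqi (h.trans hsi.2) (hbs.trans_lt hlt)).not_ge
      (R.le_w hP.se_pos.le hT hC2 (by omega))
  · have has : R.a k sStar < T sStar :=
      (PathProblem.lt_of_notMem_barrier hs
        (ha.inside sStar ⟨hsk.1.trans_lt h, hqk⟩).2).trans hlt
    exact (ha.lt_start hP hT hqk'.2 (hsk.1.trans h.le) hqk has).not_ge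
      (R.le_w hP.se_pos.le hT hC2 hk)

end NIRun

end NumInt

theorem mainTheorem1 {m : ℕ} (P : NumInt.PathProblem m) (hP : P.WellPosed)
    (V : ℝ → ℝ) (T : ℝ → ℝ) (hT : NumInt.NIFinds P P.mvc T)
    (hC1 : ∃ sStar ∈ Set.Icc 0 P.se, P.mvcStar V sStar < T sStar)
    (hC2 : ∀ s : ℝ, (s, P.mvcStar V s) ∈ P.mvcDagger V →
      ¬ P.IsDiscontinuityPoint (P.mvcStar V) s ∧ ¬ P.IsZeroInertiaPoint s) :
    (¬ ∃ T' : ℝ → ℝ, NumInt.NIFinds P (P.mvcStar V) T') ∧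
    (∀ R : NumInt.NIRun P (P.mvcStar V),
      ∀ sStar ∈ Set.Icc 0 P.se, P.mvcStar V sStar < T sStar →
      ∀ i k : ℕ, i ≤ R.n → 1 ≤ k → k ≤ R.n + 1 → R.q i < sStar → sStar < R.q k →
      ∀ s ∈ Set.Icc (R.q i) (R.h i) ∩ Set.Icc (R.l k) (R.q k),
        (s, R.b i s) ∈ P.AdmissibleRegion (P.mvcStar V) → R.b i s ≠ R.a k s) := by
  have hF := hT.2
  have hse := hP.se_pos.le
  refine ⟨?_, fun R sStar hs hlt i k hi hk1 hk hqi hqk s hsI hadm =>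
    R.beta_ne_alpha hP hF hC2 hs hlt hi hk1 hk hqi hqk hsI.1 hsI.2 hadm⟩
  rintro ⟨T', ⟨R, hR⟩, hF'⟩
  obtain ⟨sStar, hs, hlt⟩ := hC1
  have hT' : T' sStar < T sStar := (hF'.admissible sStar hs).2.2.trans_lt hlt
  have hne : ∀ k ≤ R.n, R.q k ≠ sStar := by
    rintro k hk rfl
    rcases Nat.eq_zero_or_pos k with rfl | h
    · rw [R.q_zero, hF'.start, hF.start] at hT'
      exact lt_irrefl _ hT'
    · obtain ⟨hsw, hw⟩ := R.isSwitchPoint h hk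
      exact hlt.not_ge ((hF.admissible _ hs).2.2.trans (hsw.mvc_le hC2))
  -- The connected part of the path never passes beyond `sStar`.
  have hcon : ∀ k, R.Connects T' k → R.q k ≤ sStar := by
    intro k hk
    induction hk with
    | start => exact R.q_zero ▸ hs.1
    | step i k hik hk _ mem meet acc _ ih =>
      by_contra! hqk
      have hlk := (R.alpha_profile k (by omega) hk).1.le
      refine R.beta_ne_alpha hP hF hC2 hs hlt (by omega) (by omega) hk
        (lt_of_le_of_ne ih (hne i (by omega))) hqk mem (Set.left_mem_Icc.2 hlk) ?_ meet.symm
      rw [← acc _ (Set.right_mem_Icc.2 mem.1)]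
      exact hF'.admissible _ ⟨(R.q_mem_Icc hse (by omega)).1.trans mem.1,
        mem.2.trans (R.beta_profile i (by omega)).1.le_se⟩
  have hlast := hcon _ hR
  rw [R.q_last] at hlast
  rw [hs.2.antisymm hlast, hF'.terminal, hF.terminal] at hT'
  exact lt_irrefl _ hT'
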